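/- Let $A$ be a (not necessarily unital) complex $C^*$-algebra and $H$ a complex Hilbert space. Let $\mathrm{rep}(A:H)$ be the set of all possibly degenerate representations of $A$ on $H$, i.e. of all $*$-algebra homomorphisms $\pi\colon A\to B(H)$, with the topology of pointwise convergence on $A$ with respect to the weak operator topology of $B(H)$, or, equivalently, the strong operator topology (both give the same topology on $\mathrm{rep}(A:H)$). Let $Q(A)=\{\varphi\in A^*:\varphi\ge 0,\ \|\varphi\|\le 1\}$ be the set of quasi-states and $S(A)=\{\varphi\in A^*:\varphi\ge 0,\ \|\varphi\|=1\}$ the set of states of $A$, both with the weak-$*$ topology. Assume that $H$ strictly contains a copy of every cyclic representation of $A$: for every representation $\sigma$ of $A$ on a Hilbert space $K$ that has a vector $v\in K$ with $\sigma(A)v$ dense in $K$, there is a linear isometry $K\to H$ that is not surjective. Let $\xi\in H$ be a unit vector. Then: (a) The map $\theta_\xi\colon \mathrm{rep}(A:H)\to Q(A)$, $\pi\mapsto\langle\pi(-)\xi,\xi\rangle$, is surjective and a topological quotient map, i.e. a subset $D$ of $Q(A)$ is open if and only if $\theta_\xi^{-1}(D)$ is open. (b) If $A$ is unital, put $\mathrm{rep}_\xi(A:H)=\{\pi\in\mathrm{rep}(A:H):\xi\in\pi(1)H\}$,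 with the subspace topology. Then $\theta_\xi$ maps $\mathrm{rep}_\xi(A:H)$ into $S(A)$, and the restriction $\theta_\xi\colon\mathrm{rep}_\xi(A:H)\to S(A)$ is surjective and a topological quotient map. -/

import Mathlib

open scoped ComplexOrder InnerProductSpace Topology

universe u v

namespace CStarRep

section Representations

variable (A : Type u) [NonUnitalCStarAlgebra A]
variable (H : Type v) [NormedAddCommGroup H] [InnerProductSpace ℂ H] [CompleteSpace H]

/-- `rep(A:H)`: the set of (possibly degenerate) representations of the C*-algebra `A` on the
Hilbert space `H`, that is, of `*`-algebra morphisms `A → B(H)`. It carries no topology by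
default, see `repWOT` and `repSOT`. -/
abbrev Rep : Type (max u v) := A →⋆ₙₐ[ℂ] (H →L[ℂ] H)

/-- The topology on `rep(A:H)` of pointwise convergence on `A` with respect to the weak operator
topology: it is inherited from the product topology on `B(H)^A`, where `B(H)` carries the weak
operator topology. -/
@[reducible]
noncomputable def repWOT : TopologicalSpace (Rep A H) :=
  TopologicalSpace.induced
    (fun (π : Rep A H) (a : A) => (ContinuousLinearMapWOT.ofCLM (π a) : H →WOT[ℂ] H))
    inferInstance

/-- The topology on `rep(A:H)` of pointwise convergence on `A` with respect to the strong operator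
topology (Mathlib's topology of pointwise convergence on `B(H)`). -/
@[reducible]
noncomputable def repSOT : TopologicalSpace (Rep A H) :=
  TopologicalSpace.induced
    (fun (π : Rep A H) (a : A) =>
      (ContinuousLinearMap.toPointwiseConvergenceCLM ℂ (RingHom.id ℂ) H H (π a) : H →Lₚₜ[ℂ] H))
    inferInstance

variable {A} in
/-- A representation `σ` of `A` on a Hilbert space `K` is cyclic if there is a vector `v` in `K`
with `σ(A)v` dense in `K`. -/
def IsCyclic {K : Type*} [NormedAddCommGroup K] [InnerProductSpace ℂ K] [CompleteSpace K]
    (σ : Rep A K) : Prop :=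
  ∃ v : K, Dense (Set.range fun a : A => σ a v)

/-- `H` strictly contains a copy of every cyclic representation of `A`: the Hilbert space `K` of
any cyclic representation of `A` embeds isometrically in `H`, as a proper subspace.
Every cyclic representation of `A` is unitarily equivalent to one on a space in the universe
of `A`, since its space is a completion of a quotient of `A`. -/
def StrictlyContainsCyclic : Prop :=
  ∀ (K : Type u) [NormedAddCommGroup K] [InnerProductSpace ℂ K] [CompleteSpace K] (σ : Rep A K),
    IsCyclic σ → ∃ j : K →ₗᵢ[ℂ] H, ¬ Function.Surjective j

end Representations

section States

variable (A : Type u) [NonUnitalCStarAlgebra A]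

/-- `Q(A)`: the quasi-states of `A`, i.e. the positive functionals of norm at most one. As a subset
of the weak dual, it carries the weak-* topology. -/
def QuasiState : Set (WeakDual ℂ A) :=
  {φ | (∀ a : A, 0 ≤ φ (star a * a)) ∧ ‖WeakDual.toStrongDual φ‖ ≤ 1}

/-- `S(A)`: the states of `A`, i.e. the positive functionals of norm one, with the weak-*
topology. -/
def State : Set (WeakDual ℂ A) :=
  {φ | (∀ a : A, 0 ≤ φ (star a * a)) ∧ ‖WeakDual.toStrongDual φ‖ = 1}

end States

section Theta

variable {A : Type u} [NonUnitalCStarAlgebra A]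
variable {H : Type v} [NormedAddCommGroup H] [InnerProductSpace ℂ H] [CompleteSpace H]

theorem norm_inner_rep_le (ξ : H) (π : Rep A H) (a : A) :
    ‖⟪ξ, π a ξ⟫_ℂ‖ ≤ ‖ξ‖ ^ 2 * ‖a‖ := by
  calc ‖⟪ξ, π a ξ⟫_ℂ‖ ≤ ‖ξ‖ * ‖π a ξ‖ := norm_inner_le_norm _ _
    _ ≤ ‖ξ‖ * (‖π a‖ * ‖ξ‖) := by gcongr; exact (π a).le_opNorm ξ
    _ ≤ ‖ξ‖ * (‖a‖ * ‖ξ‖) := by gcongr; exact NonUnitalStarAlgHom.norm_apply_le π a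
    _ = ‖ξ‖ ^ 2 * ‖a‖ := by ring

/-- The functional `⟨π(-)ξ, ξ⟩` on `A`. (Mathlib's inner product is linear in the second
variable.) -/
noncomputable def vectorFunctional (ξ : H) (π : Rep A H) : WeakDual ℂ A :=
  StrongDual.toWeakDual <|
    LinearMap.mkContinuous
      { toFun := fun a => ⟪ξ, π a ξ⟫_ℂ
        map_add' := fun a b => by simp
        map_smul' := fun c a => by simp }
      (‖ξ‖ ^ 2) (norm_inner_rep_le ξ π)

@[simp]
theorem vectorFunctional_apply (ξ : H) (π : Rep A H) (a : A) :
    vectorFunctional ξ π a = ⟪ξ, π a ξ⟫_ℂ := rfl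

theorem vectorFunctional_nonneg (ξ : H) (π : Rep A H) (a : A) :
    0 ≤ vectorFunctional ξ π (star a * a) := by
  rw [vectorFunctional_apply, map_mul, map_star, mul_apply_eq_comp,
    ContinuousLinearMap.star_eq_adjoint, ContinuousLinearMap.adjoint_inner_right,
    inner_self_eq_norm_sq_to_K]
  have h : (0 : ℝ) ≤ ‖π a ξ‖ ^ 2 := sq_nonneg _
  rw [← RCLike.ofReal_pow]
  exact RCLike.ofReal_nonneg.mpr h

theorem vectorFunctional_mem_quasiState {ξ : H} (hξ : ‖ξ‖ = 1) (π : Rep A H) :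
    vectorFunctional ξ π ∈ QuasiState A := by
  refine ⟨vectorFunctional_nonneg ξ π, ?_⟩
  refine ContinuousLinearMap.opNorm_le_bound _ zero_le_one fun a => ?_
  simpa [hξ] using norm_inner_rep_le ξ π a

/-- The map `θ_ξ : rep(A:H) → Q(A)`, `π ↦ ⟨π(-)ξ, ξ⟩`, for a unit vector `ξ`. -/
noncomputable def theta (ξ : H) (hξ : ‖ξ‖ = 1) (π : Rep A H) : QuasiState A :=
  ⟨vectorFunctional ξ π, vectorFunctional_mem_quasiState hξ π⟩

end Theta

section Unital

variable (A : Type u) [CStarAlgebra A]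
variable {H : Type v} [NormedAddCommGroup H] [InnerProductSpace ℂ H] [CompleteSpace H]

/-- For unital `A`, the set `rep_ξ(A:H)` of those `π` with `ξ ∈ π(1)H`. -/
def RepAt (ξ : H) : Set (Rep A H) := {π | ξ ∈ Set.range (π 1)}

variable {A}

theorem vectorFunctional_mem_state {ξ : H} (hξ : ‖ξ‖ = 1) {π : Rep A H} (hπ : π ∈ RepAt A ξ) :
    vectorFunctional ξ π ∈ State A := by
  have hq := vectorFunctional_mem_quasiState hξ π
  refine ⟨hq.1, le_antisymm hq.2 ?_⟩
  obtain ⟨η, hη⟩ := hπ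
  have h1 : π 1 ξ = ξ := by
    rw [← hη, ← mul_apply_eq_comp, ← map_mul, one_mul]
  have hval : vectorFunctional ξ π (1 : A) = 1 := by
    rw [vectorFunctional_apply, h1, inner_self_eq_norm_sq_to_K, hξ]; simp
  have : Nontrivial A := by
    refine ⟨⟨1, 0, fun h => ?_⟩⟩
    rw [h, map_zero] at hval
    exact zero_ne_one hval
  have hle := (WeakDual.toStrongDual (vectorFunctional ξ π)).le_opNorm (1 : A)
  have hval' : WeakDual.toStrongDual (vectorFunctional ξ π) (1 : A) = 1 := hval
  simpa [hval'] using hle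

/-- For unital `A`, the restriction `rep_ξ(A:H) → S(A)` of `θ_ξ`. -/
noncomputable def thetaState (ξ : H) (hξ : ‖ξ‖ = 1) (π : RepAt A ξ) : State A :=
  ⟨theta ξ hξ (π : Rep A H), vectorFunctional_mem_state hξ π.2⟩

end Unital

end CStarRep

/-! Surjectivity: the GNS construction writes a quasi-state as a vector functional of a cyclic
representation whose vector `v` has norm at most one. Since `H` strictly contains the cyclic space,
`v` can be completed by an orthogonal vector to a unit vector of `H`, and an isometry moves that
vector to `ξ`. Extending the representation by zero gives a preimage `π` that vanishes on the
orthogonal complement of `π(A)ξ` (`exists_rep_theta_eq`).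

Quotient property: for infinite-dimensional `H` it suffices to approximate such a `π` strongly by
representations lying over quasi-states `ψ` that approach `θ(π)` (`eventually_exists_rep_near`).
Take any `ρ₀` over `ψ`. The Gram matrix of `ξ` and finitely many `ρ₀(b)ξ` is read off from `ψ`,
hence is close to that of `π`, and families with close Gram matrices are close up to an isometry
(`eventually_gram_exists_isometry`). Conjugating `ρ₀` by an isometry that fixes `ξ` leaves `ψ`
unchanged and brings `ρ(b)ξ` near `π(b)ξ`. The isometry need not be unitary, because degenerate
representations are allowed; so its range can also be kept orthogonal to finitely many vectors on
which `π` vanishes. Multiplicativity carries convergence from `ξ` to `π(A)ξ`, and uniform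
contractivity carries it to all of `H` (`tendsto_repSOT`).

For finite-dimensional `H`, the space of representations is compact and `θ` is a closed map. In the
unital case `rep_ξ(A:H)` is closed and is the full preimage of `S(A)`, so the quotient property
restricts. -/

namespace CStarRep

/-! ### Isometries of Hilbert spaces -/

section Hilbert

variable {H : Type*} [NormedAddCommGroup H] [InnerProductSpace ℂ H]

/-- Isometries on a subspace and on its orthogonal complement with orthogonal ranges glue to an
isometry. -/
theorem exists_glue (S : Submodule ℂ H) [S.HasOrthogonalProjection] (T : S →ₗᵢ[ℂ] H)
    (L : H →ₗᵢ[ℂ] H) (h : ∀ s : S, ∀ x ∈ Sᗮ, ⟪T s, L x⟫_ℂ = 0) :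
    ∃ J : H →ₗᵢ[ℂ] H, (∀ s : S, J s = T s) ∧ ∀ x ∈ Sᗮ, J x = L x := by
  let f : H →ₗ[ℂ] H := T.toLinearMap ∘ₗ S.orthogonalProjectionOnto.toLinearMap +
    L.toLinearMap ∘ₗ Sᗮ.starProjection.toLinearMap
  have hf : ∀ x, f x = T (S.orthogonalProjectionOnto x) + L (Sᗮ.starProjection x) := fun x => rfl
  have hn : ∀ x, ‖f x‖ = ‖x‖ := by
    intro x
    have h1 := norm_add_sq_eq_norm_sq_add_norm_sq_of_inner_eq_zero (𝕜 := ℂ)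
      (T (S.orthogonalProjectionOnto x)) (L (Sᗮ.starProjection x))
      (h _ _ (Submodule.starProjection_apply_mem _ _))
    rw [← hf, T.norm_map, L.norm_map] at h1
    have h2 := S.norm_sq_eq_add_norm_sq_projection x
    have h3 : ‖Sᗮ.starProjection x‖ = ‖Sᗮ.orthogonalProjectionOnto x‖ := rfl
    rw [h3] at h1
    nlinarith [norm_nonneg (f x), norm_nonneg x]
  refine ⟨⟨f, hn⟩, fun s => ?_, fun x hx => ?_⟩
  · change f s = _
    simp [hf]
  · change f x = _
    rw [hf, Submodule.orthogonalProjectionOnto_apply_of_mem_orthogonal hx]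
    simp [Submodule.starProjection_eq_self_iff.mpr hx]

/-- In a finite-dimensional space, every unit vector is moved to every other one by an isometry. -/
theorem exists_isometry_apply_eq_of_finiteDimensional [FiniteDimensional ℂ H] {x y : H}
    (hx : ‖x‖ = 1) (hy : ‖y‖ = 1) : ∃ J : H →ₗᵢ[ℂ] H, J x = y := by
  have hx0 : x ≠ 0 := by rintro rfl; simp at hx
  let e := LinearIsometryEquiv.toSpanUnitSingleton (𝕜 := ℂ) x hx
  let T : (ℂ ∙ x) →ₗᵢ[ℂ] H := (LinearIsometry.toSpanSingleton ℂ H hy).comp e.symm.toLinearIsometry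
  refine ⟨T.extend, ?_⟩
  have h := T.extend_apply ⟨x, Submodule.mem_span_singleton_self x⟩
  have h2 : e.symm ⟨x, Submodule.mem_span_singleton_self x⟩ = 1 := by
    rw [LinearIsometryEquiv.symm_apply_eq]
    ext
    simp [e]
  simpa [T, h2] using h

/-- Every unit vector of an inner product space is moved to every other one by an isometry. -/
theorem exists_isometry_apply_eq {x y : H} (hx : ‖x‖ = 1) (hy : ‖y‖ = 1) :
    ∃ J : H →ₗᵢ[ℂ] H, J x = y := by
  let M : Submodule ℂ H := Submodule.span ℂ {x, y}
  have hxM : x ∈ M := Submodule.subset_span (by simp)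
  have hyM : y ∈ M := Submodule.subset_span (by simp)
  have : FiniteDimensional ℂ M := FiniteDimensional.span_of_finite ℂ (by simp)
  obtain ⟨W, hW⟩ := exists_isometry_apply_eq_of_finiteDimensional (H := M) (x := ⟨x, hxM⟩)
    (y := ⟨y, hyM⟩) hx hy
  obtain ⟨J, hJ, -⟩ := exists_glue M (M.subtypeₗᵢ.comp W) LinearIsometry.id fun s x hx =>
    Submodule.inner_right_of_mem_orthogonal (Subtype.coe_prop _) hx
  refine ⟨J, ?_⟩
  simpa [hW] using hJ ⟨x, hxM⟩

/-- An isometry between finite-dimensional spaces exists as soon as dimensions permit. -/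
theorem exists_isometry_of_finrank_le {S N : Type*} [NormedAddCommGroup S] [InnerProductSpace ℂ S]
    [FiniteDimensional ℂ S] [NormedAddCommGroup N] [InnerProductSpace ℂ N]
    [FiniteDimensional ℂ N] (h : Module.finrank ℂ S ≤ Module.finrank ℂ N) :
    Nonempty (S →ₗᵢ[ℂ] N) := by
  let b := stdOrthonormalBasis ℂ S
  let c := stdOrthonormalBasis ℂ N
  have hc : Orthonormal ℂ (c ∘ Fin.castLE h) :=
    c.orthonormal.comp _ (Fin.castLE_injective h)
  refine ⟨(b.toBasis.constr ℂ (c ∘ Fin.castLE h)).isometryOfOrthonormal (v := b.toBasis)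
    (by simp) ?_⟩
  convert hc using 1
  ext i
  simp

/-- In an infinite-dimensional Hilbert space, the orthogonal complement of a finite-dimensional
subspace contains a copy of the whole space. -/
theorem exists_isometry_into_orthogonal [CompleteSpace H] (hH : ¬ FiniteDimensional ℂ H)
    (M : Submodule ℂ H) [FiniteDimensional ℂ M] :
    ∃ L : H →ₗᵢ[ℂ] H, ∀ x, L x ∈ Mᗮ := by
  let b := stdOrthonormalBasis ℂ M
  have hb : Orthonormal ℂ fun i => (b i : H) := b.orthonormal.comp_linearIsometry M.subtypeₗᵢ
  obtain ⟨w, B, hs, hB⟩ := hb.toSubtypeRange.exists_hilbertBasis_extension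
  set s : Set H := Set.range fun i => (b i : H) with hsdef
  have hsfin : s.Finite := Set.finite_range _
  have hw : w.Infinite := by
    intro hfin
    have : Finite w := hfin
    have := Fintype.ofFinite w
    exact hH (B.toOrthonormalBasis.toBasis.finiteDimensional_of_finite)
  have : Infinite w := hw.to_subtype
  -- Discarding finitely many vectors from an infinite Hilbert basis preserves its cardinality, so
  -- the basis can be reindexed by the vectors outside `M`.
  have e : w ≃ ((Subtype.val ⁻¹' s : Set w)ᶜ : Set w) := by
    refine (Classical.choice (Cardinal.eq.mp ?_)).symm
    refine Cardinal.mk_compl_of_infinite _ ?_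
    exact ((hsfin.preimage Subtype.val_injective.injOn).lt_aleph0).trans_le
      (Cardinal.aleph0_le_mk w)
  let g : w → H := fun i => B (e i : w)
  have hg : Orthonormal ℂ g :=
    B.orthonormal.comp _ (Subtype.val_injective.comp e.injective)
  let L := hg.orthogonalFamily.linearIsometry.comp B.repr.toLinearIsometry
  refine ⟨L, fun x => ?_⟩
  have hsum := hg.orthogonalFamily.hasSum_linearIsometry (B.repr x)
  refine Submodule.isClosed_orthogonal M |>.mem_of_tendsto hsum
    (Filter.Eventually.of_forall fun t => Submodule.sum_mem _ fun i _ => ?_)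
  have hgi : g i ∈ Mᗮ := by
    have hspan : M = Submodule.span ℂ s := by
      have h1 := congrArg (Submodule.map M.subtype) b.toBasis.span_eq
      rw [Submodule.map_span, ← Set.range_comp, Submodule.map_top, Submodule.range_subtype] at h1
      rw [← h1, hsdef]
      congr 1
    rw [hspan, Submodule.mem_orthogonal]
    intro u hu
    induction hu using Submodule.span_induction with
    | mem u hu =>
      have hne : (⟨u, hs hu⟩ : w) ≠ (e i : w) := by
        intro heq
        apply (e i).2
        rw [← heq]
        exact hu
      have := B.orthonormal.2 hne
      simpa [g, hB] using this
    | zero => simp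
    | add a b _ _ ha hb => rw [inner_add_left, ha, hb, add_zero]
    | smul c a _ ha => rw [inner_smul_left, ha, mul_zero]
  simpa using Submodule.smul_mem _ _ hgi

end Hilbert

/-! ### Transport of representations along isometries -/

section Conjugation

variable {A : Type*} [NonUnitalCStarAlgebra A]
variable {K : Type*} [NormedAddCommGroup K] [InnerProductSpace ℂ K] [CompleteSpace K]
variable {H : Type*} [NormedAddCommGroup H] [InnerProductSpace ℂ H] [CompleteSpace H]

theorem adjoint_isometry_apply (j : K →ₗᵢ[ℂ] H) (x : K) :
    ContinuousLinearMap.adjoint j.toContinuousLinearMap (j x) = x := by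
  refine ext_inner_left ℂ fun y => ?_
  rw [ContinuousLinearMap.adjoint_inner_right]
  exact j.inner_map_map y x

/-- The representation `j σ(-) j*` transported along an isometry `j`; it vanishes on the orthogonal
complement of the range of `j`. -/
noncomputable def Rep.conj (j : K →ₗᵢ[ℂ] H) (σ : Rep A K) : Rep A H where
  toFun a := j.toContinuousLinearMap ∘L σ a ∘L ContinuousLinearMap.adjoint j.toContinuousLinearMap
  map_smul' c a := by ext x; simp
  map_zero' := by ext x; simp
  map_add' a b := by ext x; simp
  map_mul' a b := by
    ext x
    simp [adjoint_isometry_apply]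
  map_star' a := by
    rw [map_star, ContinuousLinearMap.star_eq_adjoint, ContinuousLinearMap.star_eq_adjoint,
      ContinuousLinearMap.adjoint_comp, ContinuousLinearMap.adjoint_comp,
      ContinuousLinearMap.adjoint_adjoint, ContinuousLinearMap.comp_assoc]

theorem Rep.conj_apply (j : K →ₗᵢ[ℂ] H) (σ : Rep A K) (a : A) (x : H) :
    σ.conj j a x = j (σ a (ContinuousLinearMap.adjoint j.toContinuousLinearMap x)) := rfl

theorem Rep.conj_apply_map (j : K →ₗᵢ[ℂ] H) (σ : Rep A K) (a : A) (x : K) :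
    σ.conj j a (j x) = j (σ a x) := by
  rw [Rep.conj_apply, adjoint_isometry_apply]

theorem Rep.conj_apply_eq_zero (j : K →ₗᵢ[ℂ] H) (σ : Rep A K) (a : A) {y : H}
    (hy : ∀ x, ⟪j x, y⟫_ℂ = 0) : σ.conj j a y = 0 := by
  have h : ContinuousLinearMap.adjoint j.toContinuousLinearMap y = 0 := by
    refine ext_inner_left ℂ fun x => ?_
    rw [ContinuousLinearMap.adjoint_inner_right, inner_zero_right]
    exact hy x
  rw [Rep.conj_apply, h, map_zero, map_zero]

end Conjugation

/-! ### The GNS construction for quasi-states -/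

section GNS

variable {A : Type u} [NonUnitalCStarAlgebra A]

/-- The Gelfand-Naimark-Segal construction for quasi-states: every quasi-state is a vector
functional of a cyclic representation. -/
theorem exists_cyclic_of_mem_quasiState {φ : WeakDual ℂ A} (hφ : φ ∈ QuasiState A) :
    ∃ (K : Type u) (_ : NormedAddCommGroup K) (_ : InnerProductSpace ℂ K) (_ : CompleteSpace K)
      (σ : Rep A K) (v : K), ‖v‖ ≤ 1 ∧ Dense (Set.range fun a => σ a v) ∧
        ∀ a, ⟪v, σ a v⟫_ℂ = φ a := by
  let _ : PartialOrder A := CStarAlgebra.spectralOrder A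
  have _ : StarOrderedRing A := CStarAlgebra.spectralOrderedRing A
  let f : A →ₚ[ℂ] ℂ := PositiveLinearMap.mk₀ (WeakDual.toStrongDual φ).toLinearMap <| by
    intro x hx
    obtain ⟨b, rfl⟩ := CStarAlgebra.nonneg_iff_eq_star_mul_self.mp hx
    exact hφ.1 b
  have hf : ∀ a, f a = φ a := fun a => rfl
  have hnorm : ∀ a, ‖f a‖ ≤ ‖a‖ := fun a => by
    have h1 := (WeakDual.toStrongDual φ).le_of_opNorm_le hφ.2 a
    rw [one_mul] at h1
    exact h1
  -- An approximate unit replaces the unit: `f (e * a)` is the inner product of `e` with `a`, and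
  -- `e` has GNS norm at most one.
  have hbound : ∀ a : A, ‖f a‖ ≤ 1 * ‖f.toPreGNS a‖ := by
    intro a
    have hau := CStarAlgebra.increasingApproximateUnit A
    have ht : Filter.Tendsto (fun e => f (e * a)) (CStarAlgebra.approximateUnit A) (𝓝 (f a)) :=
      ((WeakDual.toStrongDual φ).continuous.tendsto a).comp (hau.tendsto_mul_right a)
    refine le_of_tendsto ht.norm ?_
    filter_upwards [hau.eventually_norm, hau.eventually_star_eq] with e he hes
    have h1 : f (e * a) = ⟪f.toPreGNS e, f.toPreGNS a⟫_ℂ := by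
      rw [PositiveLinearMap.preGNS_inner_def]
      simp [hes]
    rw [h1]
    refine (norm_inner_le_norm _ _).trans ?_
    gcongr
    have h2 : ‖f.toPreGNS e‖ ^ 2 ≤ 1 := by
      have h3 := f.preGNS_norm_sq (f.toPreGNS e)
      have h4 := hnorm (star e * e)
      rw [PositiveLinearMap.ofPreGNS_toPreGNS] at h3
      rw [← h3, ← Complex.ofReal_pow, Complex.norm_real, norm_pow, norm_norm,
        CStarRing.norm_star_mul_self] at h4
      nlinarith [norm_nonneg e]
    exact (sq_le_one_iff₀ (norm_nonneg _)).mp h2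
  let g : f.PreGNS →L[ℂ] ℂ := (f.toLinearMap ∘ₗ f.ofPreGNS.toLinearMap).mkContinuous 1
    fun x => hbound (f.ofPreGNS x)
  let G : StrongDual ℂ f.GNS := g.extend UniformSpace.Completion.toComplL
  have hG : ∀ x : f.PreGNS, G x = f (f.ofPreGNS x) := fun x =>
    ContinuousLinearMap.extend_eq g (UniformSpace.Completion.denseRange_coe)
      (UniformSpace.Completion.isUniformInducing_coe _) x
  have hGn : ‖G‖ ≤ 1 := by
    refine ContinuousLinearMap.opNorm_le_bound _ zero_le_one fun x => ?_
    induction x using UniformSpace.Completion.induction_on with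
    | hp => exact isClosed_le (by fun_prop) (by fun_prop)
    | ih x =>
      rw [hG, UniformSpace.Completion.norm_coe]
      exact hbound (f.ofPreGNS x)
  -- By Riesz, `v` represents the extension of `f` to the GNS space; it plays the role of the class
  -- of the unit.
  let v : f.GNS := (InnerProductSpace.toDual ℂ f.GNS).symm G
  have hv : ∀ x : f.PreGNS, ⟪v, (x : f.GNS)⟫_ℂ = f (f.ofPreGNS x) := fun x => by
    rw [InnerProductSpace.toDual_symm_apply, hG]
  have hσv : ∀ a, f.gnsNonUnitalStarAlgHom a v = (f.toPreGNS a : f.GNS) := by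
    intro a
    refine ext_inner_right ℂ fun y => ?_
    induction y using UniformSpace.Completion.induction_on with
    | hp => exact isClosed_eq (by fun_prop) (by fun_prop)
    | ih b =>
      rw [← ContinuousLinearMap.adjoint_inner_right, ← ContinuousLinearMap.star_eq_adjoint,
        ← map_star, PositiveLinearMap.gnsNonUnitalStarAlgHom_apply_coe, hv,
        UniformSpace.Completion.inner_coe, PositiveLinearMap.preGNS_inner_def]
      simp
  refine ⟨f.GNS, inferInstance, inferInstance, inferInstance, f.gnsNonUnitalStarAlgHom, v, ?_, ?_,
    ?_⟩
  · rw [LinearIsometryEquiv.norm_map]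
    exact hGn
  · simp_rw [hσv]
    exact UniformSpace.Completion.denseRange_coe.comp f.toPreGNS.surjective.denseRange
      (UniformSpace.Completion.continuous_coe _)
  · intro a
    rw [hσv, hv]
    exact hf a

end GNS

/-! ### Surjectivity of `θ` -/

section Surjectivity

variable {A : Type u} [NonUnitalCStarAlgebra A]
variable {H : Type v} [NormedAddCommGroup H] [InnerProductSpace ℂ H] [CompleteSpace H]

/-- A vector of norm at most one in a proper subspace is the projection of a unit vector. -/
theorem exists_orthogonal_add_norm_eq_one {K : Type*} [NormedAddCommGroup K]
    [InnerProductSpace ℂ K] [CompleteSpace K] (j : K →ₗᵢ[ℂ] H) (hj : ¬ Function.Surjective j)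
    {v : K} (hv : ‖v‖ ≤ 1) : ∃ η : H, (∀ x, ⟪j x, η⟫_ℂ = 0) ∧ ‖j v + η‖ = 1 := by
  let R : Submodule ℂ H := LinearMap.range j.toLinearMap
  have hR : IsClosed (R : Set H) := by
    have := j.isometry.isUniformInducing.isComplete_range.isClosed
    exact this
  have : CompleteSpace R := hR.completeSpace_coe
  have hbot : Rᗮ ≠ ⊥ := by
    intro h
    rw [Submodule.orthogonal_eq_bot_iff] at h
    exact hj (LinearMap.range_eq_top.mp h)
  obtain ⟨y, hy, hy0⟩ := Submodule.exists_mem_ne_zero_of_ne_bot hbot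
  -- The scaling makes `‖c • y‖ ^ 2 = 1 - ‖v‖ ^ 2`.
  let c : ℂ := (Real.sqrt (1 - ‖v‖ ^ 2) / ‖y‖ : ℝ)
  have horth : ∀ x, ⟪j x, c • y⟫_ℂ = 0 := fun x => by
    have h : ⟪j x, y⟫_ℂ = 0 := Submodule.inner_right_of_mem_orthogonal (K := R) ⟨x, rfl⟩ hy
    rw [inner_smul_right, h, mul_zero]
  refine ⟨c • y, horth, ?_⟩
  have h1 := norm_add_sq_eq_norm_sq_add_norm_sq_of_inner_eq_zero (𝕜 := ℂ) _ _ (horth v)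
  have h2 : ‖c • y‖ = Real.sqrt (1 - ‖v‖ ^ 2) := by
    rw [norm_smul, Complex.norm_real, Real.norm_of_nonneg (by positivity),
      div_mul_cancel₀ _ (norm_ne_zero_iff.mpr hy0)]
  have h3 : (0 : ℝ) ≤ 1 - ‖v‖ ^ 2 := by nlinarith [norm_nonneg v]
  rw [h2, j.norm_map, Real.mul_self_sqrt h3] at h1
  nlinarith [norm_nonneg (j v + c • y)]

/-- Every quasi-state is the vector functional at `ξ` of a representation on `H` that vanishes on
the orthogonal complement of the cyclic subspace generated by `ξ`. -/
theorem exists_rep_theta_eq (hA : StrictlyContainsCyclic A H) {ξ : H} (hξ : ‖ξ‖ = 1)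
    (φ : QuasiState A) : ∃ π : Rep A H, theta ξ hξ π = φ ∧
      ∀ y, (∀ b, ⟪π b ξ, y⟫_ℂ = 0) → ∀ a, π a y = 0 := by
  obtain ⟨K, _, _, _, σ, v, hv, hdense, hφ⟩ := exists_cyclic_of_mem_quasiState φ.2
  obtain ⟨j, hj⟩ := hA K σ ⟨v, hdense⟩
  obtain ⟨η, hη, hn⟩ := exists_orthogonal_add_norm_eq_one j hj hv
  obtain ⟨J, hJ⟩ := exists_isometry_apply_eq hn hξ
  have hξv : ∀ a, σ.conj (J.comp j) a ξ = J (j (σ a v)) := by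
    intro a
    rw [← hJ, map_add, map_add, Rep.conj_apply_eq_zero (y := J η), add_zero]
    · exact Rep.conj_apply_map (J.comp j) σ a v
    · intro x
      exact (J.inner_map_map _ _).trans (hη x)
  refine ⟨σ.conj (J.comp j), ?_, ?_⟩
  · apply Subtype.ext
    apply DFunLike.ext
    intro a
    change ⟪ξ, σ.conj (J.comp j) a ξ⟫_ℂ = φ.1 a
    rw [hξv, ← hφ, ← hJ, J.inner_map_map, inner_add_left, j.inner_map_map,
      ← inner_conj_symm η, hη, map_zero, add_zero]
  · intro y hy a
    refine Rep.conj_apply_eq_zero _ _ _ fun x => ?_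
    -- Since `v` is cyclic, orthogonality to the orbit of `ξ` forces orthogonality to the whole
    -- range of `J.comp j`.
    have hcl : IsClosed {x : K | ⟪J.comp j x, y⟫_ℂ = 0} :=
      isClosed_eq (by fun_prop) continuous_const
    have hsub : Set.range (fun a => σ a v) ⊆ {x : K | ⟪J.comp j x, y⟫_ℂ = 0} := by
      rintro _ ⟨b, rfl⟩
      have := hy b
      rw [hξv] at this
      exact this
    exact hcl.closure_subset_iff.mpr hsub (hdense x)

end Surjectivity

/-! ### Stability of families under perturbation of the Gram matrix -/

section Gram

variable {N : Type*} [NormedAddCommGroup N] [InnerProductSpace ℂ N] [FiniteDimensional ℂ N]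
variable {κ : Type*} [Finite κ]

/-- Families with the same Gram matrix differ by an isometry. -/
theorem exists_isometry_of_gram_eq {u v : κ → N} (h : ∀ k l, ⟪v k, v l⟫_ℂ = ⟪u k, u l⟫_ℂ) :
    ∃ W : N →ₗᵢ[ℂ] N, ∀ k, W (v k) = u k := by
  have := Fintype.ofFinite κ
  let Lv := Fintype.linearCombination ℂ v
  let Lu := Fintype.linearCombination ℂ u
  have hin : ∀ c, ⟪Lv c, Lv c⟫_ℂ = ⟪Lu c, Lu c⟫_ℂ := by
    intro c
    simp only [Lv, Lu, Fintype.linearCombination_apply, sum_inner, inner_sum, inner_smul_left,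
      inner_smul_right, h]
  have hnorm : ∀ c, ‖Lu c‖ = ‖Lv c‖ := by
    intro c
    rw [@norm_eq_sqrt_re_inner ℂ, @norm_eq_sqrt_re_inner ℂ _ _ _ _ (Lv c), hin]
  -- Equal norms make `Lv c ↦ Lu c` a well-defined isometry on the span of `v`.
  have hker : LinearMap.ker Lv ≤ LinearMap.ker Lu := by
    intro c hc
    rw [LinearMap.mem_ker] at hc ⊢
    rw [← norm_eq_zero, hnorm, hc, norm_zero]
  let T : LinearMap.range Lv →ₗ[ℂ] N :=
    (LinearMap.ker Lv).liftQ Lu hker ∘ₗ Lv.quotKerEquivRange.symm.toLinearMap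
  have hT : ∀ c, T ⟨Lv c, c, rfl⟩ = Lu c := by
    intro c
    have : Lv.quotKerEquivRange.symm ⟨Lv c, c, rfl⟩ = (LinearMap.ker Lv).mkQ c :=
      Lv.quotKerEquivRange_symm_apply_image c ⟨c, rfl⟩
    simp [T, this]
  let T' : LinearMap.range Lv →ₗᵢ[ℂ] N := ⟨T, by
    rintro ⟨_, c, rfl⟩
    rw [hT, hnorm]
    rfl⟩
  refine ⟨T'.extend, fun k => ?_⟩
  classical
  have h1 : Lv (Pi.single k 1) = v k := by simp [Lv]
  have h2 : Lu (Pi.single k 1) = u k := by simp [Lu]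
  have h3 := T'.extend_apply ⟨Lv (Pi.single k 1), _, rfl⟩
  rw [← h2, ← hT, ← h1]
  exact h3

/-- Families with nearby Gram matrices and a common distinguished vector are close up to an
isometry fixing that vector. -/
theorem eventually_gram_exists_isometry (u : κ → N) (o : κ) {ε : ℝ} (hε : 0 < ε) :
    ∀ᶠ G in 𝓝 (fun k l => ⟪u k, u l⟫_ℂ), ∀ v : κ → N, v o = u o →
      (fun k l => ⟪v k, v l⟫_ℂ) = G →
      ∃ W : N →ₗᵢ[ℂ] N, W (u o) = u o ∧ ∀ k, ‖W (v k) - u k‖ < ε := by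
  have := Fintype.ofFinite κ
  have := FiniteDimensional.proper ℂ N
  let gram : (κ → N) → κ → κ → ℂ := fun v k l => ⟪v k, v l⟫_ℂ
  have hgram : Continuous gram := by fun_prop
  let O : Set (κ → N) := {v | ∃ W : N →ₗᵢ[ℂ] N, W (u o) = u o ∧ ∀ k, ‖W (v k) - u k‖ < ε}
  have hO : IsOpen O := by
    have : O = ⋃ W : N →ₗᵢ[ℂ] N, ⋃ _ : W (u o) = u o, ⋂ k, {v | ‖W (v k) - u k‖ < ε} := by
      ext v; simp [O]
    rw [this]
    exact isOpen_iUnion fun W => isOpen_iUnion fun _ => isOpen_iInter_of_finite fun k =>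
      isOpen_lt (by fun_prop) continuous_const
  obtain ⟨R, hR⟩ : ∃ R : ℝ, ∀ k, ‖u k‖ < R := by
    refine ⟨‖u‖ + 1, fun k => ?_⟩
    linarith [norm_le_pi_norm u k]
  -- The bounded families that no admissible isometry brings close to `u` form a compact set, so
  -- their Gram matrices form a closed set; it misses that of `u`.
  let C : Set (κ → N) := ((Set.univ.pi fun _ => Metric.closedBall 0 R) ∩ {v | v o = u o}) \ O
  have hC : IsCompact C :=
    ((isCompact_univ_pi fun _ => isCompact_closedBall _ _).inter_right
      (isClosed_eq (continuous_apply o) continuous_const)).diff hO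
  have hnot : gram u ∉ gram '' C := by
    rintro ⟨v, hv, hvu⟩
    obtain ⟨W, hW⟩ := exists_isometry_of_gram_eq (u := u) (v := v) fun k l =>
      congrFun (congrFun hvu k) l
    refine hv.2 ⟨W, ?_, fun k => ?_⟩
    · have := hW o
      rwa [hv.1.2] at this
    · rw [hW, sub_self, norm_zero]
      exact hε
  have h1 : ∀ᶠ G in 𝓝 (gram u), G ∉ gram '' C :=
    (hC.image hgram).isClosed.isOpen_compl.mem_nhds hnot
  -- Diagonal Gram entries are squared norms, so this bound confines `v` to the ball of radius `R`.
  have h2 : ∀ᶠ G : κ → κ → ℂ in 𝓝 (gram u), ∀ k, (G k k).re < R ^ 2 := by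
    rw [Filter.eventually_all]
    intro k
    have hc : Continuous fun G : κ → κ → ℂ => (G k k).re := by fun_prop
    refine hc.continuousAt.eventually_lt continuousAt_const ?_
    have := inner_self_eq_norm_sq (𝕜 := ℂ) (u k)
    change (⟪u k, u k⟫_ℂ).re < R ^ 2
    change (⟪u k, u k⟫_ℂ).re = _ at this
    rw [this]
    nlinarith [hR k, norm_nonneg (u k)]
  filter_upwards [h1, h2] with G hG1 hG2 v hvo hvG
  by_contra hcon
  refine hG1 ⟨v, ⟨⟨fun k _ => ?_, hvo⟩, hcon⟩, hvG⟩
  rw [mem_closedBall_zero_iff]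
  have h3 := hG2 k
  rw [← hvG] at h3
  have := inner_self_eq_norm_sq (𝕜 := ℂ) (v k)
  change (⟪v k, v k⟫_ℂ).re = _ at this
  rw [this] at h3
  have hR0 : 0 ≤ R := (norm_nonneg _).trans (hR k).le
  exact (pow_le_pow_iff_left₀ (norm_nonneg _) hR0 two_ne_zero).mp h3.le

end Gram

/-! ### Lifting nearby quasi-states to nearby representations -/

section Approximation

/-- In an infinite-dimensional space, every finite-dimensional subspace orthogonal to a given one is
contained in finite-dimensional such subspaces of arbitrarily large dimension. -/
theorem exists_finiteDimensional_le_orthogonal {H : Type*} [NormedAddCommGroup H]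
    [InnerProductSpace ℂ H] [CompleteSpace H] (hH : ¬ FiniteDimensional ℂ H) (P Q : Submodule ℂ H)
    [FiniteDimensional ℂ P] [FiniteDimensional ℂ Q] (hPQ : P ≤ Qᗮ) (n : ℕ) :
    ∃ N : Submodule ℂ H, FiniteDimensional ℂ N ∧ P ≤ N ∧ N ≤ Qᗮ ∧ n ≤ Module.finrank ℂ N := by
  obtain ⟨L, hL⟩ := exists_isometry_into_orthogonal hH Q
  have hrank : (n : Cardinal) ≤ Module.rank ℂ H := by
    refine Cardinal.natCast_le_aleph0.trans ?_
    rw [← not_lt, Module.rank_lt_aleph0_iff]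
    exact hH
  obtain ⟨s, hs, hli⟩ := le_rank_iff_exists_linearIndependent_finset.mp hrank
  let V : Submodule ℂ H := (Submodule.span ℂ (s : Set H)).map L.toLinearMap
  have hV : Module.finrank ℂ V = n := by
    rw [← (Submodule.equivMapOfInjective L.toLinearMap L.injective _).finrank_eq,
      finrank_span_finset_eq_card hli, hs]
  have : FiniteDimensional ℂ (Submodule.span ℂ (s : Set H)) :=
    FiniteDimensional.span_finset ℂ s
  refine ⟨P ⊔ V, inferInstance, le_sup_left, sup_le hPQ ?_, ?_⟩
  · rintro _ ⟨x, -, rfl⟩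
    exact hL x
  · rw [← hV]
    exact Submodule.finrank_mono le_sup_right

variable {A : Type u} [NonUnitalCStarAlgebra A]
variable {H : Type v} [NormedAddCommGroup H] [InnerProductSpace ℂ H] [CompleteSpace H]

/-- The vector `ξ` together with the vectors `π b ξ` for `b ∈ F`. -/
noncomputable def orbitFamily (ξ : H) (F : Finset A) (π : Rep A H) : Option F → H
  | none => ξ
  | some b => π b ξ

/-- The Gram matrix of `orbitFamily ξ F π`, in terms of the vector functional of `π` at the unit
vector `ξ`. -/
noncomputable def functionalGram (F : Finset A) (φ : WeakDual ℂ A) : Option F → Option F → ℂ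
  | none, none => 1
  | none, some b => φ b
  | some b, none => φ (star (b : A))
  | some b, some c => φ (star (b : A) * c)

/-- Moving adjoints across the inner product expresses every entry through the functional alone, so
nearby functionals have nearby Gram matrices. -/
theorem inner_orbitFamily {ξ : H} (hξ : ‖ξ‖ = 1) (F : Finset A) (π : Rep A H) (k l : Option F) :
    ⟪orbitFamily ξ F π k, orbitFamily ξ F π l⟫_ℂ =
      functionalGram F (theta ξ hξ π : WeakDual ℂ A) k l := by
  have hadj : ∀ (b : A) (x : H), ⟪π b ξ, x⟫_ℂ = ⟪ξ, π (star b) x⟫_ℂ := fun b x => by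
    rw [map_star, ContinuousLinearMap.star_eq_adjoint, ContinuousLinearMap.adjoint_inner_right]
  cases k <;> cases l <;> simp only [orbitFamily, functionalGram, theta, vectorFunctional_apply]
  · rw [inner_self_eq_norm_sq_to_K, hξ]; simp
  · rw [hadj]
  · rw [hadj, map_mul]; rfl

theorem continuous_functionalGram (F : Finset A) :
    Continuous fun φ : QuasiState A => functionalGram F (φ : WeakDual ℂ A) := by
  refine continuous_pi fun k => continuous_pi fun l => ?_
  have h : ∀ a : A, Continuous fun φ : QuasiState A => (φ : WeakDual ℂ A) a := fun a =>
    (WeakDual.eval_continuous a).comp continuous_subtype_val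
  cases k <;> cases l <;> simp only [functionalGram]
  exacts [continuous_const, h _, h _, h _]

/-- In the infinite-dimensional case, quasi-states near that of `π` come from representations near
`π`. -/
theorem eventually_exists_rep_near (hA : StrictlyContainsCyclic A H)
    (hH : ¬ FiniteDimensional ℂ H) {ξ : H} (hξ : ‖ξ‖ = 1) (π : Rep A H) (F : Finset A)
    (E : Finset H) (hE : ∀ y ∈ E, ⟪ξ, y⟫_ℂ = 0 ∧ ∀ b, ⟪π b ξ, y⟫_ℂ = 0) {ε : ℝ} (hε : 0 < ε) :
    ∀ᶠ ψ in 𝓝 (theta ξ hξ π), ∃ ρ : Rep A H, theta ξ hξ ρ = ψ ∧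
      (∀ b ∈ F, ‖ρ b ξ - π b ξ‖ < ε) ∧ ∀ y ∈ E, ∀ a, ρ a y = 0 := by
  let P : Submodule ℂ H := Submodule.span ℂ (Set.range (orbitFamily ξ F π))
  let Q : Submodule ℂ H := Submodule.span ℂ (E : Set H)
  have : FiniteDimensional ℂ P := FiniteDimensional.span_of_finite ℂ (Set.finite_range _)
  have : FiniteDimensional ℂ Q := FiniteDimensional.span_finset ℂ E
  have hPQ : P ≤ Qᗮ := by
    change P ⟂ Q
    refine Submodule.isOrtho_span.mpr ?_
    rintro _ ⟨k, rfl⟩ y hy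
    cases k
    exacts [(hE y hy).1, (hE y hy).2 _]
  -- The dimension bound lets the span of `orbitFamily ξ F ρ₀` embed in `N`, whatever `ρ₀` is.
  obtain ⟨N, hN, hPN, hNQ, hdim⟩ := exists_finiteDimensional_le_orthogonal hH P Q hPQ
    (Fintype.card (Option F))
  obtain ⟨L, hL⟩ := exists_isometry_into_orthogonal hH (N ⊔ Q)
  let u : Option F → N := fun k =>
    ⟨orbitFamily ξ F π k, hPN (Submodule.subset_span (Set.mem_range_self k))⟩
  have hu : (fun k l => ⟪u k, u l⟫_ℂ) = functionalGram F (theta ξ hξ π : WeakDual ℂ A) := by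
    ext k l
    exact inner_orbitFamily hξ F π k l
  have hgram := eventually_gram_exists_isometry u none hε
  rw [hu] at hgram
  filter_upwards [(continuous_functionalGram F).continuousAt.eventually hgram] with ψ hψ
  obtain ⟨ρ₀, hρ₀, -⟩ := exists_rep_theta_eq hA hξ ψ
  let S : Submodule ℂ H := Submodule.span ℂ (Set.range (orbitFamily ξ F ρ₀))
  have : FiniteDimensional ℂ S := FiniteDimensional.span_of_finite ℂ (Set.finite_range _)
  let s : Option F → S := fun k =>
    ⟨orbitFamily ξ F ρ₀ k, Submodule.subset_span (Set.mem_range_self k)⟩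
  have hSN : Module.finrank ℂ S ≤ Module.finrank ℂ N := (finrank_range_le_card _).trans hdim
  obtain ⟨T₀⟩ := exists_isometry_of_finrank_le hSN
  -- `V` puts the image of `ξ` back at `ξ`; `W` then keeps it there and brings the rest of the orbit
  -- close to that of `π`.
  obtain ⟨V, hV⟩ := exists_isometry_apply_eq_of_finiteDimensional (x := T₀ (s none))
    (y := u none) ((T₀.norm_map _).trans hξ) hξ
  obtain ⟨W, hW, hWu⟩ := hψ (fun k => V (T₀ (s k))) hV <| by
    ext k l
    rw [V.inner_map_map, T₀.inner_map_map, ← hρ₀]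
    exact inner_orbitFamily hξ F ρ₀ k l
  let T : S →ₗᵢ[ℂ] H := N.subtypeₗᵢ.comp (W.comp (V.comp T₀))
  have hTN : ∀ x, T x ∈ N := fun x => Subtype.coe_prop _
  -- `T` maps into `N` and `L` into the orthogonal complement of `N ⊔ Q`, so the range of `J` is
  -- orthogonal to `E`.
  obtain ⟨J, hJT, hJL⟩ := exists_glue S T L fun x y _ =>
    Submodule.inner_right_of_mem_orthogonal (Submodule.mem_sup_left (hTN x)) (hL y)
  have hJξ : J ξ = ξ := by
    have h1 : T (s none) = ξ := by
      change ((W (V (T₀ (s none))) : N) : H) = ξ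
      rw [hV, hW]
      rfl
    exact (hJT (s none)).trans h1
  have hρξ : ∀ a, ρ₀.conj J a ξ = J (ρ₀ a ξ) := fun a => by
    conv_lhs => rw [← hJξ]
    exact Rep.conj_apply_map J ρ₀ a ξ
  refine ⟨ρ₀.conj J, ?_, fun b hb => ?_, fun y hy a => Rep.conj_apply_eq_zero _ _ _ fun x => ?_⟩
  · rw [← hρ₀]
    apply Subtype.ext
    apply DFunLike.ext
    intro a
    change ⟪ξ, ρ₀.conj J a ξ⟫_ℂ = ⟪ξ, ρ₀ a ξ⟫_ℂ
    rw [hρξ]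
    exact (congrArg (fun z => ⟪z, J (ρ₀ a ξ)⟫_ℂ) hJξ.symm).trans (J.inner_map_map _ _)
  · rw [hρξ]
    have h1 : J (ρ₀ b ξ) = T (s (some ⟨b, hb⟩)) := hJT (s (some ⟨b, hb⟩))
    rw [h1]
    exact hWu (some ⟨b, hb⟩)
  · have hyQ : y ∈ Q := Submodule.subset_span hy
    obtain ⟨x₁, hx₁, x₂, hx₂, rfl⟩ := S.exists_add_mem_mem_orthogonal x
    rw [map_add, inner_add_left, hJT ⟨x₁, hx₁⟩, hJL x₂ hx₂,
      Submodule.inner_left_of_mem_orthogonal hyQ (hNQ (hTN _)),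
      Submodule.inner_left_of_mem_orthogonal (Submodule.mem_sup_right hyQ) (hL _), add_zero]

end Approximation

/-! ### Topologies on the space of representations -/

section Topologies

variable {A : Type u} [NonUnitalCStarAlgebra A]
variable {H : Type v} [NormedAddCommGroup H] [InnerProductSpace ℂ H] [CompleteSpace H]

theorem le_repSOT_iff (t : TopologicalSpace (Rep A H)) :
    t ≤ repSOT A H ↔ ∀ (a : A) (x : H), Continuous fun π : Rep A H => π a x := by
  rw [repSOT, ← continuous_iff_le_induced, continuous_pi_iff]
  exact forall_congr' fun a =>
    ⟨fun h x => (continuous_eval_const (F := H →Lₚₜ[ℂ] H) x).comp h,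
      PointwiseConvergenceCLM.continuous_of_continuous_eval⟩

theorem continuous_inner_apply_repWOT (a : A) (x y : H) :
    Continuous[repWOT A H, inferInstance] fun π : Rep A H => ⟪y, π a x⟫_ℂ := by
  let _ := repWOT A H
  have h1 : Continuous fun (π : Rep A H) (a : A) =>
      (ContinuousLinearMapWOT.ofCLM (π a) : H →WOT[ℂ] H) := continuous_induced_dom
  exact (ContinuousLinearMapWOT.continuous_dual_apply x (innerSL ℂ y)).comp
    ((continuous_apply a).comp h1)

theorem repSOT_le_repWOT : repSOT A H ≤ repWOT A H := by
  let _ := repSOT A H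
  rw [repWOT, ← continuous_iff_le_induced]
  refine continuous_pi fun a => ContinuousLinearMapWOT.continuous_of_dual_apply_continuous
    fun x y => ?_
  exact y.continuous.comp ((le_repSOT_iff (repSOT A H)).mp le_rfl a x)

theorem continuous_theta_repWOT (ξ : H) (hξ : ‖ξ‖ = 1) :
    Continuous[repWOT A H, inferInstance] (theta (A := A) ξ hξ) := by
  let _ := repWOT A H
  exact Continuous.subtype_mk (WeakDual.continuous_of_continuous_eval fun a =>
    continuous_inner_apply_repWOT a ξ ξ) _

/-- The topology of pointwise convergence in norm. -/
@[reducible]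
noncomputable def repNorm (A : Type u) [NonUnitalCStarAlgebra A] (H : Type v)
    [NormedAddCommGroup H] [InnerProductSpace ℂ H] [CompleteSpace H] :
    TopologicalSpace (Rep A H) :=
  TopologicalSpace.induced (fun (π : Rep A H) (a : A) => π a) inferInstance

theorem repNorm_le_repSOT : repNorm A H ≤ repSOT A H := by
  let _ := repNorm A H
  rw [le_repSOT_iff]
  intro a x
  have h : Continuous fun (π : Rep A H) (a : A) => π a := continuous_induced_dom
  exact (ContinuousLinearMap.apply ℂ H x).continuous.comp ((continuous_apply a).comp h)

/-- Representations are contractive, so they lie in a product of compact balls. Multiplication is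
jointly continuous in norm, so the algebraic identities cut out a closed subset. -/
theorem compactSpace_repNorm [FiniteDimensional ℂ H] : @CompactSpace (Rep A H) (repNorm A H) := by
  let _ := repNorm A H
  have : ProperSpace (H →L[ℂ] H) := FiniteDimensional.proper ℂ _
  have hind : Topology.IsInducing fun (π : Rep A H) (a : A) => π a := ⟨rfl⟩
  let C : Set (A → H →L[ℂ] H) := {f | (∀ a b, f (a + b) = f a + f b) ∧
    (∀ a b, f (a * b) = f a * f b) ∧ (∀ (c : ℂ) a, f (c • a) = c • f a) ∧
    ∀ a, f (star a) = star (f a)}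
  have hC : IsClosed C := by
    simp only [C, Set.ofPred_and, Set.ofPred_forall]
    refine IsClosed.inter ?_ (IsClosed.inter ?_ (IsClosed.inter ?_ ?_))
    · exact isClosed_iInter fun a => isClosed_iInter fun b => isClosed_eq (by fun_prop)
        (by fun_prop)
    · exact isClosed_iInter fun a => isClosed_iInter fun b => isClosed_eq (by fun_prop)
        (by fun_prop)
    · exact isClosed_iInter fun a => isClosed_iInter fun b => isClosed_eq (by fun_prop)
        (by fun_prop)
    · exact isClosed_iInter fun a => isClosed_eq (by fun_prop) (by fun_prop)
  have hrange : Set.range (fun (π : Rep A H) (a : A) => π a) =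
      (Set.univ.pi fun a => Metric.closedBall 0 ‖a‖) ∩ C := by
    ext f
    constructor
    · rintro ⟨π, rfl⟩
      refine ⟨fun a _ => ?_, map_add π, map_mul π, map_smul π, map_star π⟩
      rw [mem_closedBall_zero_iff]
      exact NonUnitalStarAlgHom.norm_apply_le π a
    · rintro ⟨-, hadd, hmul, hsmul, hstar⟩
      have hzero : f 0 = 0 := by simpa using hsmul 0 0
      exact ⟨{ toFun := f, map_smul' := hsmul, map_zero' := hzero, map_add' := hadd,
               map_mul' := hmul, map_star' := hstar }, rfl⟩
  refine ⟨?_⟩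
  rw [hind.isCompact_iff, Set.image_univ, hrange]
  exact (isCompact_univ_pi fun a => isCompact_closedBall _ _).inter_right hC

/-- For a net of representations, strong convergence may be checked on a set of vectors with its
orthogonal complement. -/
theorem tendsto_repSOT {ι : Type*} {l : Filter ι} {ρ : ι → Rep A H} {π : Rep A H} (T : Set H)
    (hT : ∀ x ∈ T, ∀ a, Filter.Tendsto (fun i => ρ i a x) l (𝓝 (π a x)))
    (hT' : ∀ y, (∀ x ∈ T, ⟪x, y⟫_ℂ = 0) →
      ∀ a, Filter.Tendsto (fun i => ρ i a y) l (𝓝 (π a y))) :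
    Filter.Tendsto ρ l (@nhds _ (repSOT A H) π) := by
  rw [nhds_induced, Filter.tendsto_comap_iff, tendsto_pi_nhds]
  intro a
  refine PointwiseConvergenceCLM.tendsto_iff_forall_tendsto.mpr fun x => ?_
  change Filter.Tendsto (fun i => ρ i a x) l (𝓝 (π a x))
  let X : Submodule ℂ H :=
    { carrier := {x | Filter.Tendsto (fun i => ρ i a x) l (𝓝 (π a x))}
      zero_mem' := by simpa using tendsto_const_nhds
      add_mem' := fun {x y} hx hy => by
        have := Filter.Tendsto.add hx hy
        simpa using this
      smul_mem' := fun c x hx => by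
        have := Filter.Tendsto.const_smul hx c
        simpa using this }
  -- The operators `ρ i a` are uniformly bounded by `‖a‖`, hence equicontinuous.
  have hX : IsClosed (X : Set H) := by
    have heq : Equicontinuous fun i => (ρ i a : H → H) := by
      refine (LipschitzWith.uniformEquicontinuous _ ‖a‖₊ fun i => ?_).equicontinuous
      refine ((ρ i a).lipschitz).weaken ?_
      exact NonUnitalStarAlgHom.norm_apply_le (ρ i) a
    exact heq.isClosed_setOfPred_tendsto (π a).continuous
  let V := (Submodule.span ℂ T).topologicalClosure
  have hV : V ≤ X := Submodule.topologicalClosure_minimal _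
    (Submodule.span_le.mpr fun x hx => hT x hx a) hX
  have : CompleteSpace V := (Submodule.isClosed_topologicalClosure _).completeSpace_coe
  obtain ⟨x₁, hx₁, x₂, hx₂, rfl⟩ := V.exists_add_mem_mem_orthogonal x
  refine X.add_mem (hV hx₁) (hT' x₂ (fun x hx => ?_) a)
  exact Submodule.inner_right_of_mem_orthogonal
    (Submodule.le_topologicalClosure _ (Submodule.subset_span hx)) hx₂

end Topologies

/-! ### The quotient property of `θ` -/

section Quotient

variable {A : Type u} [NonUnitalCStarAlgebra A]
variable {H : Type v} [NormedAddCommGroup H] [InnerProductSpace ℂ H] [CompleteSpace H]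

theorem surjective_theta (hA : StrictlyContainsCyclic A H) {ξ : H} (hξ : ‖ξ‖ = 1) :
    Function.Surjective (theta (A := A) ξ hξ) := fun φ =>
  let ⟨π, hπ, _⟩ := exists_rep_theta_eq hA hξ φ
  ⟨π, hπ⟩

theorem isOpen_of_isOpen_preimage_theta_of_finiteDimensional [FiniteDimensional ℂ H]
    (hA : StrictlyContainsCyclic A H) {ξ : H} (hξ : ‖ξ‖ = 1) {D : Set (QuasiState A)}
    (hD : IsOpen[repSOT A H] (theta ξ hξ ⁻¹' D)) : IsOpen D := by
  let _ := repNorm A H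
  have := compactSpace_repNorm (A := A) (H := H)
  have hc : Continuous (theta (A := A) ξ hξ) :=
    continuous_le_dom (repNorm_le_repSOT.trans repSOT_le_repWOT) (continuous_theta_repWOT ξ hξ)
  exact (hc.isClosedMap.isQuotientMap hc (surjective_theta hA hξ)).isOpen_preimage.mp
    (repNorm_le_repSOT _ hD)

/-- If `D` were not a neighbourhood of one of its points, a net of representations lying over the
complement of `D` would converge strongly to a point of the open set `θ⁻¹(D)`. -/
theorem isOpen_of_isOpen_preimage_theta_of_not_finiteDimensional (hH : ¬ FiniteDimensional ℂ H)
    (hA : StrictlyContainsCyclic A H) {ξ : H} (hξ : ‖ξ‖ = 1) {D : Set (QuasiState A)}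
    (hD : IsOpen[repSOT A H] (theta ξ hξ ⁻¹' D)) : IsOpen D := by
  classical
  refine isOpen_iff_mem_nhds.mpr fun φ hφ => ?_
  obtain ⟨π, rfl, hπ⟩ := exists_rep_theta_eq hA hξ φ
  by_contra hcon
  have hfreq : ∃ᶠ ψ in 𝓝 (theta ξ hξ π), ψ ∉ D := Filter.not_eventually.mp hcon
  -- An index records finitely many algebra elements, finitely many vectors to annihilate, and a
  -- tolerance `1 / (n + 1)`.
  have key : ∀ i : Finset A × Finset {y : H // ⟪ξ, y⟫_ℂ = 0 ∧ ∀ b, ⟪π b ξ, y⟫_ℂ = 0} × ℕ,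
      ∃ ρ : Rep A H, theta ξ hξ ρ ∉ D ∧ (∀ b ∈ i.1, ‖ρ b ξ - π b ξ‖ < 1 / ((i.2.2 : ℝ) + 1)) ∧
        ∀ y ∈ i.2.1, ∀ a, ρ a y = 0 := by
    intro i
    obtain ⟨ψ, hψD, ρ, rfl, h1, h2⟩ := (hfreq.and_eventually
      (eventually_exists_rep_near hA hH hξ π i.1 (i.2.1.image Subtype.val)
        (fun y hy => by
          obtain ⟨z, -, rfl⟩ := Finset.mem_image.mp hy
          exact z.2)
        (Nat.one_div_pos_of_nat (n := i.2.2) (α := ℝ)))).exists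
    exact ⟨ρ, hψD, h1, fun y hy => h2 y (Finset.mem_image_of_mem _ hy)⟩
  choose ρ hρD hρξ hρ0 using key
  have hlim : ∀ b, Filter.Tendsto (fun i => ρ i b ξ) Filter.atTop (𝓝 (π b ξ)) := by
    intro b
    rw [Metric.tendsto_nhds]
    intro ε hε
    obtain ⟨n, hn⟩ := exists_nat_one_div_lt hε
    filter_upwards [Filter.eventually_ge_atTop (({b}, ∅, n) : Finset A ×
      Finset {y : H // ⟪ξ, y⟫_ℂ = 0 ∧ ∀ b, ⟪π b ξ, y⟫_ℂ = 0} × ℕ)] with i hi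
    rw [dist_eq_norm]
    refine (hρξ i b (hi.1 (Finset.mem_singleton_self b))).trans (lt_of_le_of_lt ?_ hn)
    have : (n : ℝ) ≤ i.2.2 := by exact_mod_cast hi.2.2
    gcongr
  have htend : Filter.Tendsto ρ Filter.atTop (@nhds _ (repSOT A H) π) := by
    refine tendsto_repSOT (insert ξ (Set.range fun b => π b ξ)) ?_ ?_
    · rintro x (rfl | ⟨b, rfl⟩) a
      · exact hlim a
      -- Split `π b ξ` as `ρ i b ξ` plus an error: the first part is handled by `ρ i a (ρ i b ξ) = ρ
      -- i (a * b) ξ`, the error by contractivity.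
      · have h1 : Filter.Tendsto (fun i => ρ i a (ρ i b ξ)) Filter.atTop (𝓝 (π a (π b ξ))) := by
          have := hlim (a * b)
          simpa only [map_mul, mul_apply_eq_comp] using this
        have h2 : Filter.Tendsto (fun i => ρ i a (π b ξ - ρ i b ξ)) Filter.atTop (𝓝 0) := by
          have h3 : Filter.Tendsto (fun i => ‖a‖ * ‖π b ξ - ρ i b ξ‖) Filter.atTop (𝓝 0) := by
            simpa using ((tendsto_const_nhds.sub (hlim b)).norm.const_mul ‖a‖ :
              Filter.Tendsto (fun i => ‖a‖ * ‖π b ξ - ρ i b ξ‖) _ _)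
          refine squeeze_zero_norm (fun i => ?_) h3
          exact (ρ i a).le_of_opNorm_le (NonUnitalStarAlgHom.norm_apply_le (ρ i) a) _
        simpa using h1.add h2
    · intro y hy a
      have hyE : ⟪ξ, y⟫_ℂ = 0 ∧ ∀ b, ⟪π b ξ, y⟫_ℂ = 0 :=
        ⟨hy ξ (Set.mem_insert _ _), fun b => hy _ (Set.mem_insert_of_mem _ ⟨b, rfl⟩)⟩
      rw [hπ y hyE.2 a]
      refine tendsto_const_nhds.congr' ?_
      filter_upwards [Filter.eventually_ge_atTop ((∅, {⟨y, hyE⟩}, 0) : Finset A ×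
        Finset {y : H // ⟪ξ, y⟫_ℂ = 0 ∧ ∀ b, ⟪π b ξ, y⟫_ℂ = 0} × ℕ)] with i hi
      exact (hρ0 i ⟨y, hyE⟩ (hi.2.1 (Finset.mem_singleton_self _)) a).symm
  have hmem : theta ξ hξ ⁻¹' D ∈ @nhds _ (repSOT A H) π := by
    let _ := repSOT A H
    exact IsOpen.mem_nhds hD hφ
  obtain ⟨i, hi⟩ := (htend.eventually_mem hmem).exists
  exact hρD i hi

/-- Both topologies follow at once: continuity is proved for the weaker one, and openness of `D` is
deduced from the stronger one. -/
theorem isQuotientMap_theta (hA : StrictlyContainsCyclic A H) {ξ : H} (hξ : ‖ξ‖ = 1)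
    {t : TopologicalSpace (Rep A H)} (ht : t = repWOT A H ∨ t = repSOT A H) :
    Topology.IsQuotientMap (theta (A := A) ξ hξ) := by
  have hle : repSOT A H ≤ t ∧ t ≤ repWOT A H := by
    rcases ht with rfl | rfl
    exacts [⟨repSOT_le_repWOT, le_rfl⟩, ⟨le_rfl, repSOT_le_repWOT⟩]
  have hc : Continuous (theta (A := A) ξ hξ) :=
    continuous_le_dom hle.2 (continuous_theta_repWOT ξ hξ)
  refine ⟨.of_isOpen_preimage_iff_isOpen fun D => ⟨fun hD => ?_, fun hD => hD.preimage hc⟩,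
    surjective_theta hA hξ⟩
  have hD' : IsOpen[repSOT A H] (theta ξ hξ ⁻¹' D) := hle.1 _ hD
  by_cases hH : FiniteDimensional ℂ H
  · exact isOpen_of_isOpen_preimage_theta_of_finiteDimensional hA hξ hD'
  · exact isOpen_of_isOpen_preimage_theta_of_not_finiteDimensional hH hA hξ hD'

end Quotient

/-! ### The unital case -/

section UnitalQuotient

variable {A : Type u} [CStarAlgebra A]
variable {H : Type v} [NormedAddCommGroup H] [InnerProductSpace ℂ H] [CompleteSpace H]

theorem inner_rep_mul_eq (π : Rep A H) (x : H) (a : A) :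
    ⟪x, π a x⟫_ℂ = ⟪π 1 x, π a (π 1 x)⟫_ℂ := by
  have h : π 1 = ContinuousLinearMap.adjoint (π 1) := by
    rw [← ContinuousLinearMap.star_eq_adjoint, ← map_star, star_one]
  conv_rhs => rw [h, ContinuousLinearMap.adjoint_inner_left, ← h]
  rw [← mul_apply_eq_comp, ← mul_apply_eq_comp, ← map_mul, ← map_mul, mul_one, one_mul]

/-- `π 1` is a projection, so by Pythagoras a unit vector whose norm it does not decrease is fixed.
-/
theorem mem_repAt_of_one_le {ξ : H} (hξ : ‖ξ‖ = 1) {π : Rep A H} (h : 1 ≤ ‖π 1 ξ‖) :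
    π ∈ RepAt A ξ := by
  have hidem : π 1 (π 1 ξ) = π 1 ξ := by rw [← mul_apply_eq_comp, ← map_mul, one_mul]
  have hself := inner_rep_mul_eq π ξ 1
  rw [hidem] at hself
  have horth : ⟪π 1 ξ, ξ - π 1 ξ⟫_ℂ = 0 := by
    rw [inner_sub_right, ← inner_conj_symm, hself, inner_conj_symm, sub_self]
  have h1 := norm_add_sq_eq_norm_sq_add_norm_sq_of_inner_eq_zero (𝕜 := ℂ) _ _ horth
  rw [add_sub_cancel, hξ] at h1
  have h2 : ‖ξ - π 1 ξ‖ = 0 := by nlinarith [norm_nonneg (ξ - π 1 ξ)]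
  exact ⟨ξ, (sub_eq_zero.mp (norm_eq_zero.mp h2)).symm⟩

/-- The functional depends only on `π 1 ξ`, so its norm is at most `‖π 1 ξ‖ ^ 2`. -/
theorem mem_repAt_of_mem_state {ξ : H} (hξ : ‖ξ‖ = 1) {π : Rep A H}
    (h : vectorFunctional ξ π ∈ State A) : π ∈ RepAt A ξ := by
  refine mem_repAt_of_one_le hξ ?_
  have hb : ‖WeakDual.toStrongDual (vectorFunctional ξ π)‖ ≤ ‖π 1 ξ‖ ^ 2 := by
    refine ContinuousLinearMap.opNorm_le_bound _ (by positivity) fun a => ?_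
    change ‖⟪ξ, π a ξ⟫_ℂ‖ ≤ _
    rw [inner_rep_mul_eq]
    exact norm_inner_rep_le _ π a
  rw [h.2] at hb
  exact (one_le_sq_iff₀ (norm_nonneg _)).mp hb

theorem mem_repAt_iff {ξ : H} (hξ : ‖ξ‖ = 1) {π : Rep A H} :
    π ∈ RepAt A ξ ↔ (theta ξ hξ π : WeakDual ℂ A) 1 = 1 := by
  change _ ↔ ⟪ξ, π 1 ξ⟫_ℂ = 1
  constructor
  · rintro ⟨η, hη⟩
    rw [← hη, ← mul_apply_eq_comp, ← map_mul, one_mul, hη, inner_self_eq_norm_sq_to_K, hξ]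
    simp
  · intro h
    refine mem_repAt_of_one_le hξ ?_
    have := norm_inner_le_norm (𝕜 := ℂ) ξ (π 1 ξ)
    rwa [h, hξ, norm_one, one_mul] at this

theorem isQuotientMap_thetaState (hA : StrictlyContainsCyclic A H) {ξ : H} (hξ : ‖ξ‖ = 1)
    {t : TopologicalSpace (Rep A H)} (ht : t = repWOT A H ∨ t = repSOT A H) :
    Topology.IsQuotientMap (thetaState (A := A) ξ hξ) := by
  have hq := isQuotientMap_theta hA hξ ht
  have hclosed : IsClosed (RepAt A ξ : Set (Rep A H)) := by
    have h1 : Continuous fun π : Rep A H => (theta ξ hξ π : WeakDual ℂ A) 1 :=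
      (WeakDual.eval_continuous 1).comp (continuous_subtype_val.comp hq.continuous)
    have h2 : RepAt A ξ = {π : Rep A H | (theta ξ hξ π : WeakDual ℂ A) 1 = 1} :=
      Set.ext fun π => mem_repAt_iff hξ
    rw [h2]
    exact isClosed_eq h1 continuous_const
  refine Topology.isQuotientMap_iff_isClosed.mpr
    ⟨fun φ => ?_, fun D => ⟨fun hD => ?_, fun hD => ?_⟩⟩
  · obtain ⟨π, hπ⟩ := hq.surjective ⟨φ.1, φ.2.1, φ.2.2.le⟩
    have hπ' : vectorFunctional ξ π = φ.1 := congrArg Subtype.val hπ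
    exact ⟨⟨π, mem_repAt_of_mem_state hξ (hπ' ▸ φ.2)⟩, Subtype.ext hπ'⟩
  · refine hD.preimage ?_
    exact Continuous.subtype_mk
      (continuous_subtype_val.comp (hq.continuous.comp continuous_subtype_val)) _
  · let incl : State A → QuasiState A := fun φ => ⟨φ.1, φ.2.1, φ.2.2.le⟩
    have hincl : Continuous incl := Continuous.subtype_mk continuous_subtype_val _
    have hinj : Function.Injective incl := fun φ ψ h =>
      Subtype.ext (congrArg (fun χ : QuasiState A => (χ : WeakDual ℂ A)) h)
    -- Any `π` over a state lies in `RepAt A ξ`, so no preimages are lost by restricting; closedness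
    -- of `RepAt A ξ` then makes this set closed in all of `Rep A H`.
    have hpre : theta ξ hξ ⁻¹' (incl '' D) = Subtype.val '' (thetaState ξ hξ ⁻¹' D) := by
      ext π
      constructor
      · rintro ⟨φ, hφ, hπ⟩
        have hπ' : φ.1 = vectorFunctional ξ π := congrArg Subtype.val hπ
        have hmem : π ∈ RepAt A ξ := mem_repAt_of_mem_state hξ (hπ' ▸ φ.2)
        have heq : thetaState ξ hξ ⟨π, hmem⟩ = φ := Subtype.ext hπ'.symm
        refine ⟨⟨π, hmem⟩, ?_, rfl⟩
        rw [Set.mem_preimage, heq]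
        exact hφ
      · rintro ⟨π, hπ, rfl⟩
        exact ⟨_, hπ, rfl⟩
    have himg : IsClosed (incl '' D) := by
      rw [← hq.isClosed_preimage, hpre]
      exact hclosed.isClosedMap_subtype_val _ hD
    rw [← Set.preimage_image_eq D hinj]
    exact himg.preimage hincl

end UnitalQuotient

end CStarRep

theorem theorem2p5 :
    (∀ (A : Type u) [NonUnitalCStarAlgebra A]
        (H : Type v) [NormedAddCommGroup H] [InnerProductSpace ℂ H] [CompleteSpace H],
        CStarRep.StrictlyContainsCyclic A H → ∀ (ξ : H) (hξ : ‖ξ‖ = 1),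
        ∀ t : TopologicalSpace (CStarRep.Rep A H),
          t = CStarRep.repWOT A H ∨ t = CStarRep.repSOT A H →
          Function.Surjective (CStarRep.theta (A := A) ξ hξ) ∧
          Topology.IsQuotientMap (CStarRep.theta (A := A) ξ hξ)) ∧
    (∀ (A : Type u) [CStarAlgebra A]
        (H : Type v) [NormedAddCommGroup H] [InnerProductSpace ℂ H] [CompleteSpace H],
        CStarRep.StrictlyContainsCyclic A H → ∀ (ξ : H) (hξ : ‖ξ‖ = 1),
        ∀ t : TopologicalSpace (CStarRep.Rep A H),
          t = CStarRep.repWOT A H ∨ t = CStarRep.repSOT A H →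
          Topology.IsQuotientMap (CStarRep.thetaState (A := A) ξ hξ)) :=
  ⟨fun _ _ _ _ _ _ hA _ hξ _ ht =>
    ⟨CStarRep.surjective_theta hA hξ, CStarRep.isQuotientMap_theta hA hξ ht⟩,
    fun _ _ _ _ _ _ hA _ hξ _ ht => CStarRep.isQuotientMap_thetaState hA hξ ht⟩
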